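/- For $m\in\{0,1,2,\dots\}$ let $H_m=\sum_{i=1}^m \frac1i$ (so $H_0=0$), let $Li_s(x)=\sum_{k=1}^\infty \frac{x^k}{k^s}$ and let $\zeta$ be the Riemann zeta function; empty sums are $0$. For every natural number $n$ and every real $t$ with $0<t\le 1$, the following series converges absolutely and $$ \begin{aligned} \sum_{k=1}^{\infty}\frac{(-t)^kH_{k-1}}{k^2\binom{n+k}{k}} ={}&\frac12\log t\,\log^2(1+t)-\frac13\log^3(1+t)-\log(1+t)\,Li_2\Big(\frac1{1+t}\Big)-Li_3\Big(\frac1{1+t}\Big)+\zeta(3)\\ &+\log(1+t)\sum_{k=1}^{n}\frac{H_k}{k}\Big(\frac{t+1}{t}\Big)^k-\frac12\log^2(1+t)\sum_{k=1}^{n}\frac1k\Big(\frac{t+1}{t}\Big)^k\\ &-\sum_{p=0}^{n-1}\bigg\{\sum_{k=1}^{n-p}\bigg(\frac{H_{p+k}-H_k}{(p+k)k}+\frac{1}{k^2(p+k)}\bigg)\bigg\}\Big(\frac{t+1}{t}\Big)^p . \end{aligned} $$ -/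

import Mathlib

/-- The real polylogarithm `Li_s(x) = ∑_{k ≥ 1} x^k / k^s`, the series being indexed by `k = j + 1`
(it is absolutely convergent for `|x| < 1`, and for `|x| ≤ 1` if `s ≥ 2`). -/
noncomputable def polylog (s : ℕ) (x : ℝ) : ℝ :=
  ∑' j : ℕ, x ^ (j + 1) / ((j + 1 : ℕ) : ℝ) ^ s

/-- The harmonic number `H_m = ∑_{i=1}^m 1/i` (`H_0 = 0`) as a real number. -/
noncomputable def H (m : ℕ) : ℝ := (harmonic m : ℝ)

/-!
Write `F n t` for the series and `G n t` for the claimed closed form. Both satisfy, with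
primes for derivatives in `t`,

* `t * (F 0)' = log² (1 + t) / 2`,
* `t * (F (n + 1))' = (n + 1) * (F n - F (n + 1))` on `(0, 1)`,

so `t ^ n * (F n - G n)` has derivative zero, by induction on `n`. It is continuous on `(0, 1]` and
tends to `0` as `t → 0⁺`, hence vanishes (`eq_zero_of_hasDerivAt_zero_of_tendsto_zero`); as both
sides are continuous at `t = 1`, this endpoint needs no separate treatment.

For the series, the equations are termwise: the coefficients satisfy `binomCoeff_succ_mul`, and
`n = 0` reduces to the generating function `∑ H_{k-1} x^k / k = log² (1 - x) / 2`
(`powSeries_H_div_neg`). For the closed form, the part independent of `n` is differentiated through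
`u * Li_{s+1}'(u) = Li_s(u)` (`hasDerivAt_polylogPart`). The rest is a polynomial in `L = log (1 + t)`
and `x = (t + 1) / t`, for which `t * L' = 1 / x` and `t * x' = -(x - 1)`; comparing coefficients leaves
a telescoping sum for each of `L` and `L²`, and, for the terms free of `L`, the two-term recurrence
`innerCoeff_recurrence` of the inner sums (`hasDerivAt_polyPart`).

At `t → 0⁺` the polylogarithms contribute `-Li_3(1) + ζ(3) = 0` (`tendsto_polylogPart`), and the
factor `t ^ n` cancels the poles of the polynomial part (`tendsto_pow_mul_polyPart`).
-/

/-! ### A uniqueness principle -/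

open Filter Topology Set in
/-- The uniqueness principle behind both comparisons of a series with its closed form. The limit at
`0` is one-sided and `f 0` is irrelevant, because the closed forms involve `log t` and negative
powers of `t`. -/
theorem eq_zero_of_hasDerivAt_zero_of_tendsto_zero {f : ℝ → ℝ} {b : ℝ} (hb : 0 < b)
    (hc : ContinuousOn f (Ioc 0 b)) (hd : ∀ x ∈ Ioo 0 b, HasDerivAt f 0 x)
    (hl : Tendsto f (𝓝[>] 0) (𝓝 0)) : f b = 0 := by
  have h : ∀ s ∈ Ioo 0 b, f s = f b := by
    intro s hs
    obtain ⟨c, -, h⟩ := exists_hasDerivAt_eq_slope f (fun _ => 0) hs.2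
      (hc.mono fun y hy => ⟨hs.1.trans_le hy.1, hy.2⟩)
      (fun y hy => hd y ⟨hs.1.trans hy.1, hy.2⟩)
    have hne : b - s ≠ 0 := sub_ne_zero.2 hs.2.ne'
    field_simp at h
    linarith
  have h2 : Tendsto f (𝓝[>] 0) (𝓝 (f b)) := by
    refine tendsto_const_nhds.congr' ?_
    filter_upwards [Ioo_mem_nhdsGT hb] with s hs using (h s hs).symm
  exact tendsto_nhds_unique h2 hl

/-! ### Power series without constant term -/

/-- The power series `∑_{k ≥ 1} a_k x^k` without constant term; the coefficient of `x ^ (j + 1)`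
is `a j`, as in `polylog`. -/
noncomputable def powSeries (a : ℕ → ℝ) (x : ℝ) : ℝ := ∑' j : ℕ, a j * x ^ (j + 1)

theorem summable_powSeries {a : ℕ → ℝ} (ha : ∀ j : ℕ, |a j| ≤ j + 1) {x : ℝ} (hx : |x| < 1) :
    Summable fun j : ℕ => a j * x ^ (j + 1) := by
  have hs : Summable fun j : ℕ => ((j + 1 : ℕ) : ℝ) ^ 1 * |x| ^ (j + 1) :=
    (summable_nat_add_iff 1).2
      (summable_pow_mul_geometric_of_norm_lt_one (R := ℝ) 1 (r := |x|) (by simpa using hx))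
  refine Summable.of_norm_bounded hs fun j => ?_
  rw [norm_mul, norm_pow, Real.norm_eq_abs, Real.norm_eq_abs, pow_one]
  push_cast
  exact mul_le_mul_of_nonneg_right (ha j) (by positivity)

open Set in
/-- Termwise differentiation, valid also at `x = 0`, where the form of `hasDerivAt_powSeries`
divides by zero. -/
theorem hasDerivAt_powSeries_tsum {a : ℕ → ℝ} (ha : ∀ j, |a j| ≤ 1) {x : ℝ} (hx : |x| < 1) :
    HasDerivAt (powSeries a) (∑' j : ℕ, a j * (((j + 1 : ℕ) : ℝ) * x ^ j)) x := by
  obtain ⟨r, hxr, hr⟩ := exists_between hx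
  have hr0 : 0 < r := (abs_nonneg x).trans_lt hxr
  have hu : Summable fun j : ℕ => ((j : ℝ) + 1) * r ^ j := by
    have h1 := summable_pow_mul_geometric_of_norm_lt_one (R := ℝ) 1 (r := r)
      (by rwa [Real.norm_eq_abs, abs_of_pos hr0])
    refine (h1.add (summable_geometric_of_lt_one hr0.le hr)).congr fun j => ?_
    simp [add_mul]
  refine hasDerivAt_tsum_of_isPreconnected (g := fun j z => a j * z ^ (j + 1))
    (g' := fun j z => a j * (((j + 1 : ℕ) : ℝ) * z ^ j)) (t := Ioo (-r) r) (y₀ := 0) hu isOpen_Ioo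
    isPreconnected_Ioo (fun j y _ => ?_) (fun j y hy => ?_) ⟨by linarith, hr0⟩ ?_ (abs_lt.1 hxr)
  · simpa using (hasDerivAt_pow (j + 1) y).const_mul (a j)
  · have hy' : |y| ≤ r := (abs_lt.2 hy).le
    rw [norm_mul, norm_mul, norm_pow, Real.norm_eq_abs, Real.norm_eq_abs, Real.norm_eq_abs,
      abs_of_nonneg (by positivity : (0 : ℝ) ≤ ((j + 1 : ℕ) : ℝ))]
    push_cast
    calc |a j| * (((j : ℝ) + 1) * |y| ^ j) ≤ 1 * (((j : ℝ) + 1) * r ^ j) := by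
          gcongr
          exact ha j
      _ = _ := one_mul _
  · simp

/-- The Euler operator `x d/dx` multiplies the coefficient of `x ^ (j + 1)` by `j + 1`. -/
theorem hasDerivAt_powSeries {a : ℕ → ℝ} (ha : ∀ j, |a j| ≤ 1) {x : ℝ} (hx : |x| < 1)
    (hx0 : x ≠ 0) :
    HasDerivAt (powSeries a) (powSeries (fun j => a j * (j + 1)) x / x) x := by
  refine (hasDerivAt_powSeries_tsum ha hx).congr_deriv ?_
  rw [eq_div_iff hx0, ← tsum_mul_right]
  refine tsum_congr fun j => ?_
  push_cast
  ring

open Set in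
theorem continuousOn_powSeries {a : ℕ → ℝ} (ha : Summable fun j => |a j|) :
    ContinuousOn (powSeries a) (Icc (-1) 1) := by
  refine continuousOn_tsum (fun j => by fun_prop) ha fun j x hx => ?_
  rw [norm_mul, norm_pow, Real.norm_eq_abs, Real.norm_eq_abs]
  exact mul_le_of_le_one_right (abs_nonneg _) (pow_le_one₀ (abs_nonneg _) (abs_le.2 hx))

theorem powSeries_zero (a : ℕ → ℝ) : powSeries a 0 = 0 := by
  simp [powSeries]

/-! ### Polylogarithms -/

theorem polylog_eq_powSeries (s : ℕ) :
    polylog s = powSeries fun j => 1 / ((j + 1 : ℕ) : ℝ) ^ s := by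
  funext x
  exact tsum_congr fun j => by ring

theorem polylog_one {x : ℝ} (hx : |x| < 1) : polylog 1 x = -Real.log (1 - x) := by
  rw [← (Real.hasSum_pow_div_log_of_abs_lt_one hx).tsum_eq]
  exact tsum_congr fun j => by simp

theorem hasDerivAt_polylog (s : ℕ) {x : ℝ} (hx : |x| < 1) (hx0 : x ≠ 0) :
    HasDerivAt (polylog (s + 1)) (polylog s x / x) x := by
  rw [polylog_eq_powSeries, polylog_eq_powSeries]
  convert hasDerivAt_powSeries (fun j => ?_) hx hx0 using 4 with j
  · have : (j : ℝ) + 1 ≠ 0 := by positivity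
    push_cast
    field_simp
    ring
  · rw [abs_of_nonneg (by positivity)]
    have h1 : (1 : ℝ) ≤ ((j + 1 : ℕ) : ℝ) := by simp
    exact div_le_one_of_le₀ (one_le_pow₀ h1) (by positivity)

open Set in
theorem continuousOn_polylog {s : ℕ} (hs : 2 ≤ s) : ContinuousOn (polylog s) (Icc (-1) 1) := by
  rw [polylog_eq_powSeries]
  refine continuousOn_powSeries ?_
  refine Summable.congr ((summable_nat_add_iff 1).2
    (Real.summable_one_div_nat_pow (p := s) |>.2 (by omega))) fun j => ?_
  rw [abs_of_nonneg (by positivity)]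

theorem polylog_three_one : polylog 3 1 = (riemannZeta 3).re := by
  have h := zeta_nat_eq_tsum_of_gt_one (k := 3) (by norm_num)
  have h3 : (∑' n : ℕ, 1 / (n : ℂ) ^ 3) = ((∑' n : ℕ, 1 / (n : ℝ) ^ 3 : ℝ) : ℂ) := by
    push_cast
    rfl
  rw [h3] at h
  norm_num only [Nat.cast_ofNat] at h
  rw [h, Complex.ofReal_re, polylog,
    (Real.summable_one_div_nat_pow (p := 3) |>.2 (by norm_num)).tsum_eq_zero_add]
  simp

/-! ### Harmonic numbers and their generating functions -/

theorem H_zero : H 0 = 0 := by simp [H]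

theorem H_succ (m : ℕ) : H (m + 1) = H m + 1 / ((m : ℝ) + 1) := by
  simp [H, harmonic_succ]

theorem H_nonneg (m : ℕ) : 0 ≤ H m := by
  induction m with
  | zero => simp [H_zero]
  | succ m ih =>
    rw [H_succ]
    positivity

theorem H_le_self (m : ℕ) : H m ≤ m := by
  induction m with
  | zero => simp [H_zero]
  | succ m ih =>
    rw [H_succ]
    push_cast
    have : 1 / ((m : ℝ) + 1) ≤ 1 := div_le_one_of_le₀ (by linarith [m.cast_nonneg (α := ℝ)])
      (by positivity)
    linarith

/-- A bound on `H` just strong enough to make `∑ H_j / (j + 1)²` convergent. -/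
theorem H_le_two_mul_sqrt (m : ℕ) : H m ≤ 2 * √m := by
  induction m with
  | zero => simp [H_zero]
  | succ m ih =>
    rw [H_succ]
    push_cast
    have h1 := Real.sq_sqrt (m.cast_nonneg (α := ℝ))
    have h2 := Real.sq_sqrt (by positivity : (0 : ℝ) ≤ (m : ℝ) + 1)
    have h3 : √(m : ℝ) ≤ √((m : ℝ) + 1) := Real.sqrt_le_sqrt (by linarith)
    have h4 : 0 < √((m : ℝ) + 1) := by positivity
    have h6 : 1 ≤ √((m : ℝ) + 1) := Real.one_le_sqrt.2 (by linarith [m.cast_nonneg (α := ℝ)])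
    have : 1 / ((m : ℝ) + 1) ≤ 2 * √((m : ℝ) + 1) - 2 * √m := by
      rw [div_le_iff₀ (by positivity)]
      set u := √(m : ℝ)
      set v := √((m : ℝ) + 1)
      have h7 : (v - u) * (v + u) = 1 := by linarith [mul_comm u v]
      rw [← h2]
      nlinarith [mul_nonneg (sub_nonneg.2 h3) (mul_nonneg h4.le (sub_nonneg.2 h6)),
        sq_nonneg (v - u)]
    linarith

theorem summable_H_div_sq : Summable fun j : ℕ => H j / ((j + 1 : ℕ) : ℝ) ^ 2 := by
  have hs : Summable fun j : ℕ => 2 * (1 / ((j + 1 : ℕ) : ℝ) ^ (3 / 2 : ℝ)) :=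
    ((summable_nat_add_iff 1).2
      (Real.summable_one_div_nat_rpow (p := 3 / 2) |>.2 (by norm_num))).mul_left 2
  refine Summable.of_nonneg_of_le (fun j => div_nonneg (H_nonneg j) (by positivity))
    (fun j => ?_) hs
  have hj : (0 : ℝ) < ((j + 1 : ℕ) : ℝ) := by positivity
  have h1 : H j ≤ 2 * √((j + 1 : ℕ) : ℝ) :=
    (H_le_two_mul_sqrt j).trans (by gcongr; simp)
  have h2 : √((j + 1 : ℕ) : ℝ) * ((j + 1 : ℕ) : ℝ) ^ (3 / 2 : ℝ) = ((j + 1 : ℕ) : ℝ) ^ 2 := by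
    rw [Real.sqrt_eq_rpow, ← Real.rpow_add hj, ← Real.rpow_natCast]
    norm_num
  rw [div_le_iff₀ (by positivity), ← h2]
  have h3 : 0 < ((j + 1 : ℕ) : ℝ) ^ (3 / 2 : ℝ) := Real.rpow_pos_of_pos hj _
  calc H j ≤ 2 * √((j + 1 : ℕ) : ℝ) := h1
    _ = _ := by field_simp

/-- The generating function of the harmonic numbers, `∑ H_j x^j = -log (1 - x) / (1 - x)`,
multiplied by `x (1 - x)`. -/
theorem one_sub_mul_powSeries_H {x : ℝ} (hx : |x| < 1) :
    (1 - x) * powSeries H x = -x * Real.log (1 - x) := by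
  have hb : ∀ j : ℕ, |H j| ≤ j + 1 := fun j => by
    rw [abs_of_nonneg (H_nonneg j)]
    linarith [H_le_self j]
  have hs := summable_powSeries hb hx
  have hl := Real.hasSum_pow_div_log_of_abs_lt_one hx
  have h1 : powSeries H x = x * (powSeries H x - Real.log (1 - x)) := by
    conv_lhs => rw [powSeries, hs.tsum_eq_zero_add]
    rw [sub_eq_add_neg, ← hl.tsum_eq, powSeries, ← hs.tsum_add hl.summable, ← tsum_mul_left,
      H_zero, zero_mul, zero_add]
    refine tsum_congr fun j => ?_
    rw [H_succ]
    ring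
  linear_combination h1

open Filter Topology Set in
/-- The classical generating function `∑_{k ≥ 1} H_{k-1} x^k / k = log² (1 - x) / 2`, here for
`x = -t`. -/
theorem powSeries_H_div_neg {t : ℝ} (ht0 : 0 < t) (ht1 : t < 1) :
    powSeries (fun j => H j / ((j : ℝ) + 1)) (-t) = 1 / 2 * Real.log (1 + t) ^ 2 := by
  have hb : ∀ j : ℕ, |H j / ((j : ℝ) + 1)| ≤ 1 := fun j => by
    rw [abs_of_nonneg (div_nonneg (H_nonneg j) (by positivity))]
    exact div_le_one_of_le₀ (by linarith [H_le_self j]) (by positivity)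
  set f : ℝ → ℝ :=
    fun s => powSeries (fun j => H j / ((j : ℝ) + 1)) (-s) - 1 / 2 * Real.log (1 + s) ^ 2 with hf
  have hd : ∀ s ∈ Ioo (0 : ℝ) 1, HasDerivAt f 0 s := by
    intro s hs
    have hs1 : |(-s)| < 1 := by rw [abs_neg, abs_of_pos hs.1]; exact hs.2
    have h1 := (hasDerivAt_powSeries hb hs1 (neg_ne_zero.2 hs.1.ne')).comp s (hasDerivAt_neg s)
    have h2 := ((((hasDerivAt_id s).const_add 1).log
      (by simp only [id]; linarith [hs.1])).pow 2).const_mul (1 / 2)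
    refine (h1.sub h2).congr_deriv ?_
    have h3 : (fun j : ℕ => H j / ((j : ℝ) + 1) * (j + 1)) = H := by
      funext j
      have : (j : ℝ) + 1 ≠ 0 := by positivity
      field_simp
    have h4 := one_sub_mul_powSeries_H hs1
    have hs0 := hs.1.ne'
    have hs2 : 1 + s ≠ 0 := by linarith [hs.1]
    rw [h3]
    simp only [id, sub_neg_eq_add, neg_neg] at h4 ⊢
    have h5 : powSeries H (-s) = s * Real.log (1 + s) / (1 + s) := by
      rw [eq_div_iff hs2]
      linear_combination h4
    rw [h5]
    field_simp
    ring
  have hc : ContinuousAt f 0 := by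
    have h1 : ContinuousAt (powSeries fun j => H j / ((j : ℝ) + 1)) (-0) :=
      (hasDerivAt_powSeries_tsum hb (by simp)).continuousAt
    have h2 : ContinuousAt (fun s : ℝ => Real.log (1 + s)) 0 :=
      ContinuousAt.log (by fun_prop) (by norm_num)
    exact (ContinuousAt.comp (f := fun s : ℝ => -s) h1 continuousAt_neg).sub
      (continuousAt_const.mul (h2.pow 2))
  have hf0 : f 0 = 0 := by simp [hf, powSeries_zero]
  refine sub_eq_zero.1 (eq_zero_of_hasDerivAt_zero_of_tendsto_zero (f := f) ht0
    (fun s hs => (hd s ⟨hs.1, hs.2.trans_lt ht1⟩).continuousAt.continuousWithinAt)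
    (fun s hs => hd s ⟨hs.1, hs.2.trans ht1⟩) ?_)
  have := hc.tendsto.mono_left (nhdsWithin_le_nhds (s := Ioi 0))
  rwa [hf0] at this

/-! ### The differential equation of the series -/

/-- The coefficients of `∑ (-t)^k H_{k-1} / (k² C(n+k,k))` as a power series in `-t`. -/
noncomputable def binomCoeff (n j : ℕ) : ℝ :=
  H j / (((j + 1 : ℕ) : ℝ) ^ 2 * ((n + (j + 1)).choose (j + 1) : ℝ))

theorem binomCoeff_nonneg (n j : ℕ) : 0 ≤ binomCoeff n j :=
  div_nonneg (H_nonneg j) (by positivity)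

theorem binomCoeff_le (n j : ℕ) : binomCoeff n j ≤ H j / ((j + 1 : ℕ) : ℝ) ^ 2 := by
  have h1 : (1 : ℝ) ≤ ((n + (j + 1)).choose (j + 1) : ℝ) := by
    exact_mod_cast Nat.choose_pos (by omega)
  exact div_le_div_of_nonneg_left (H_nonneg j) (by positivity)
    (le_mul_of_one_le_right (by positivity) h1)

theorem abs_binomCoeff_le_one (n j : ℕ) : |binomCoeff n j| ≤ 1 := by
  rw [abs_of_nonneg (binomCoeff_nonneg n j)]
  refine (binomCoeff_le n j).trans (div_le_one_of_le₀ ?_ (by positivity))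
  have := H_le_self j
  push_cast
  nlinarith [j.cast_nonneg (α := ℝ)]

theorem summable_abs_binomCoeff (n : ℕ) : Summable fun j => |binomCoeff n j| :=
  Summable.of_nonneg_of_le (fun _ => abs_nonneg _)
    (fun j => by rw [abs_of_nonneg (binomCoeff_nonneg n j)]; exact binomCoeff_le n j)
    summable_H_div_sq

theorem binomCoeff_succ_mul (n j : ℕ) :
    binomCoeff (n + 1) j * (j + 1) = (n + 1) * (binomCoeff n j - binomCoeff (n + 1) j) := by
  have h : ((n + 1 + (j + 1)).choose (j + 1) : ℝ) * (n + 1)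
      = ((n + (j + 1)).choose (j + 1) : ℝ) * (n + j + 2) := by
    have h0 := Nat.choose_mul_succ_eq (n + (j + 1)) (j + 1)
    rw [show n + (j + 1) + 1 - (j + 1) = n + 1 by omega,
      show n + (j + 1) + 1 = n + 1 + (j + 1) by omega] at h0
    have h1 : (((n + (j + 1)).choose (j + 1) : ℕ) : ℝ) * ((n + 1 + (j + 1) : ℕ) : ℝ)
        = ((n + 1 + (j + 1)).choose (j + 1) : ℝ) * ((n + 1 : ℕ) : ℝ) := by exact_mod_cast h0
    push_cast at h1
    linear_combination -h1
  have h1 : ((n + 1 + (j + 1)).choose (j + 1) : ℝ) ≠ 0 := by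
    exact_mod_cast (Nat.choose_pos (by omega)).ne'
  have h2 : ((n + (j + 1)).choose (j + 1) : ℝ) ≠ 0 := by
    exact_mod_cast (Nat.choose_pos (by omega)).ne'
  have hj : ((j + 1 : ℕ) : ℝ) ≠ 0 := by positivity
  unfold binomCoeff
  field_simp
  linear_combination (-H j) * h

theorem hasDerivAt_powSeries_binomCoeff_zero {t : ℝ} (ht0 : 0 < t) (ht1 : t < 1) :
    HasDerivAt (fun s => powSeries (binomCoeff 0) (-s)) (1 / 2 * Real.log (1 + t) ^ 2 / t) t := by
  have ht : |(-t)| < 1 := by rwa [abs_neg, abs_of_pos ht0]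
  refine ((hasDerivAt_powSeries (abs_binomCoeff_le_one 0) ht (neg_ne_zero.2 ht0.ne')).comp t
    (hasDerivAt_neg t)).congr_deriv ?_
  rw [← powSeries_H_div_neg ht0 ht1]
  have h : (fun j : ℕ => binomCoeff 0 j * (j + 1)) = fun j : ℕ => H j / ((j : ℝ) + 1) := by
    funext j
    have : (j : ℝ) + 1 ≠ 0 := by positivity
    simp only [binomCoeff, zero_add, Nat.choose_self]
    push_cast
    field_simp
  rw [h]
  field_simp

/-- The Euler operator lowers `n`: `t F_{n+1}' = (n + 1) (F_n - F_{n+1})`. -/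
theorem hasDerivAt_powSeries_binomCoeff_succ (n : ℕ) {t : ℝ} (ht0 : 0 < t) (ht1 : t < 1) :
    HasDerivAt (fun s => powSeries (binomCoeff (n + 1)) (-s))
      ((n + 1) * (powSeries (binomCoeff n) (-t) - powSeries (binomCoeff (n + 1)) (-t)) / t) t := by
  have ht : |(-t)| < 1 := by rwa [abs_neg, abs_of_pos ht0]
  have hb : ∀ n j : ℕ, |binomCoeff n j| ≤ j + 1 := fun n j =>
    (abs_binomCoeff_le_one n j).trans (by simp)
  refine ((hasDerivAt_powSeries (abs_binomCoeff_le_one (n + 1)) ht (neg_ne_zero.2 ht0.ne')).comp t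
    (hasDerivAt_neg t)).congr_deriv ?_
  have h : powSeries (fun j => binomCoeff (n + 1) j * (j + 1)) (-t) =
      (n + 1) * (powSeries (binomCoeff n) (-t) - powSeries (binomCoeff (n + 1)) (-t)) := by
    rw [powSeries, powSeries, powSeries,
      ← (summable_powSeries (hb n) ht).tsum_sub (summable_powSeries (hb (n + 1)) ht),
      ← tsum_mul_left]
    refine tsum_congr fun j => ?_
    rw [binomCoeff_succ_mul]
    ring
  rw [h]
  field_simp

/-! ### The differential equation of the polynomial part -/

/-- The inner sum `∑_{k=1}^m ((H_{p+k} - H_k) / ((p+k) k) + 1 / (k² (p+k)))`; for `m = n - p` it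
is the coefficient of `((t+1)/t)^p` in the closed form. -/
noncomputable def innerCoeff (p m : ℕ) : ℝ :=
  ∑ k ∈ Finset.Icc 1 m,
    ((H (p + k) - H k) / (((p : ℝ) + (k : ℝ)) * (k : ℝ)) + 1 / ((k : ℝ) ^ 2 * ((p : ℝ) + (k : ℝ))))

theorem innerCoeff_zero (p : ℕ) : innerCoeff p 0 = 0 := by simp [innerCoeff]

theorem innerCoeff_succ (p m : ℕ) :
    innerCoeff p (m + 1) = innerCoeff p m +
      ((H (p + m + 1) - H (m + 1)) / ((p + m + 1) * (m + 1))
        + 1 / (((m : ℝ) + 1) ^ 2 * (p + m + 1))) := by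
  rw [innerCoeff, Finset.sum_Icc_succ_top (by omega), ← innerCoeff]
  push_cast
  simp only [add_assoc]

/-- The coefficient of `x ^ p` in the differential equation for `polyPart`, with `n = p + m + 1`. It
holds by induction on `m` because the increments of `innerCoeff` are explicit. -/
theorem innerCoeff_recurrence (p m : ℕ) :
    H (p + 1) / (p + 1) + p * innerCoeff p (m + 1) - (p + 1) * innerCoeff (p + 1) m
      = (p + m + 1) * (innerCoeff p (m + 1) - innerCoeff p m) := by
  induction m with
  | zero =>
    rw [innerCoeff_succ, innerCoeff_zero, innerCoeff_zero]
    have : (p : ℝ) + 1 ≠ 0 := by positivity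
    simp only [Nat.cast_zero, add_zero, zero_add]
    rw [H_succ 0, H_zero]
    simp only [Nat.cast_zero]
    field_simp
    ring
  | succ m ih =>
    rw [innerCoeff_succ p m] at ih
    rw [innerCoeff_succ p (m + 1), innerCoeff_succ p m, innerCoeff_succ (p + 1) m]
    rw [show p + 1 + m + 1 = p + (m + 1) + 1 by omega, H_succ (p + (m + 1)), H_succ (m + 1)]
    rw [show p + (m + 1) = p + m + 1 by omega]
    have h1 : (p : ℝ) + m + 1 ≠ 0 := by positivity
    have h2 : (p : ℝ) + m + 1 + 1 ≠ 0 := by positivity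
    have h3 : (m : ℝ) + 1 ≠ 0 := by positivity
    have h4 : (m : ℝ) + 1 + 1 ≠ 0 := by positivity
    push_cast
    have h5 : (p : ℝ) + (m + 1) + 1 = p + m + 1 + 1 := by ring
    have h6 : (p : ℝ) + 1 + m + 1 = p + m + 1 + 1 := by ring
    rw [h5, h6]
    set X := H (p + 1) / ((p : ℝ) + 1)
    set Y := innerCoeff p m
    set Z := innerCoeff (p + 1) m
    set U := H (p + m + 1)
    set V := H (m + 1)
    have ih' : X + p * Y - (p + 1) * Z = (m + 1) * ((U - V) / ((p + m + 1) * (m + 1))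
        + 1 / (((m : ℝ) + 1) ^ 2 * (p + m + 1))) := by linear_combination ih
    -- eliminating `X` leaves an identity of rational functions in `p`, `m`, `U`, `V`, `Y`, `Z`
    have : X = (m + 1) * ((U - V) / ((p + m + 1) * (m + 1))
        + 1 / (((m : ℝ) + 1) ^ 2 * (p + m + 1))) - p * Y + (p + 1) * Z := by
      linear_combination ih'
    rw [this]
    field_simp
    ring

/-- The part of the closed form that is polynomial in `L = log (1 + t)` and `x = (t + 1) / t`. -/
noncomputable def polyPart (n : ℕ) (L x : ℝ) : ℝ :=
  L * ∑ k ∈ Finset.Icc 1 n, H k / (k : ℝ) * x ^ k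
    - 1 / 2 * L ^ 2 * ∑ k ∈ Finset.Icc 1 n, 1 / (k : ℝ) * x ^ k
    - ∑ p ∈ Finset.range n, innerCoeff p (n - p) * x ^ p

theorem sum_Icc_one_eq_sum_range (f : ℕ → ℝ) (n : ℕ) :
    ∑ k ∈ Finset.Icc 1 n, f k = ∑ j ∈ Finset.range n, f (j + 1) := by
  induction n with
  | zero => simp
  | succ n ih => rw [Finset.sum_Icc_succ_top (by omega), Finset.sum_range_succ, ih]

/-- The coefficient of `L` in the differential equation for `polyPart`. -/
theorem sum_H_succ_mul_pow (n : ℕ) (x : ℝ) :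
    ∑ j ∈ Finset.range n, (H (j + 1) * x ^ j * (x - 1) + x ^ j / ((j : ℝ) + 1)) = H n * x ^ n := by
  induction n with
  | zero => simp [H_zero]
  | succ n ih =>
    rw [Finset.sum_range_succ, ih, H_succ]
    ring

/-- The terms free of `L` in the differential equation for `polyPart`, summed from
`innerCoeff_recurrence`. -/
theorem sum_innerCoeff_mul_pow (n : ℕ) (x : ℝ) :
    ∑ j ∈ Finset.range n, H (j + 1) / ((j : ℝ) + 1) * x ^ j
      + (x - 1) * ∑ p ∈ Finset.range n, innerCoeff p (n - p) * (p * x ^ (p - 1))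
      = n * ∑ p ∈ Finset.range n, (innerCoeff p (n - p) - innerCoeff p (n - p - 1)) * x ^ p := by
  -- shift the index: the term `p = 0` vanishes, and the new term `p = n` has `innerCoeff n 0 = 0`
  have h1 : ∑ p ∈ Finset.range n, innerCoeff p (n - p) * (p * x ^ (p - 1))
      = ∑ p ∈ Finset.range n, innerCoeff (p + 1) (n - (p + 1)) * ((p + 1) * x ^ p) := by
    have h := Finset.sum_range_succ' (fun p => innerCoeff p (n - p) * (p * x ^ (p - 1))) n
    rw [Finset.sum_range_succ] at h
    simpa [innerCoeff_zero] using h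
  have h2 : x * ∑ p ∈ Finset.range n, innerCoeff p (n - p) * (p * x ^ (p - 1))
      = ∑ p ∈ Finset.range n, innerCoeff p (n - p) * (p * x ^ p) := by
    rw [Finset.mul_sum]
    refine Finset.sum_congr rfl fun p _ => ?_
    rcases p with _ | p
    · simp
    · rw [Nat.add_sub_cancel]
      ring
  rw [sub_mul, one_mul, h2, h1, ← Finset.sum_sub_distrib, ← Finset.sum_add_distrib,
    Finset.mul_sum]
  refine Finset.sum_congr rfl fun p hp => ?_
  obtain ⟨m, rfl⟩ : ∃ m, n = p + m + 1 := ⟨n - p - 1, by have := Finset.mem_range.1 hp; omega⟩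
  rw [show p + m + 1 - p = m + 1 by omega, show p + m + 1 - (p + 1) = m by omega,
    show m + 1 - 1 = m by omega]
  have h := innerCoeff_recurrence p m
  push_cast
  linear_combination x ^ p * h

theorem polyPart_succ_sub (n : ℕ) (L x : ℝ) :
    polyPart (n + 1) L x - polyPart n L x = (L * H (n + 1) - 1 / 2 * L ^ 2) / (n + 1) * x ^ (n + 1)
      - ∑ p ∈ Finset.range (n + 1),
        (innerCoeff p (n + 1 - p) - innerCoeff p (n + 1 - p - 1)) * x ^ p := by
  have h : ∑ p ∈ Finset.range n, innerCoeff p (n - p) * x ^ p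
      = ∑ p ∈ Finset.range (n + 1), innerCoeff p (n + 1 - p - 1) * x ^ p := by
    rw [Finset.sum_range_succ]
    simp only [show n + 1 - n - 1 = 0 by omega, innerCoeff_zero, zero_mul, add_zero]
    refine Finset.sum_congr rfl fun p _ => ?_
    rw [show n + 1 - p - 1 = n - p by omega]
  simp only [sub_mul]
  rw [Finset.sum_sub_distrib, polyPart, polyPart, h, Finset.sum_Icc_succ_top (by omega),
    Finset.sum_Icc_succ_top (by omega)]
  push_cast
  ring

/-- The polynomial part satisfies the differential equation of the series, up to `-L² / 2`, which
the derivative of `polylogPart` compensates. -/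
theorem hasDerivAt_polyPart (n : ℕ) {t : ℝ} (ht : 0 < t) :
    HasDerivAt (fun s => polyPart (n + 1) (Real.log (1 + s)) ((s + 1) / s))
      (((n + 1) * (polyPart n (Real.log (1 + t)) ((t + 1) / t)
        - polyPart (n + 1) (Real.log (1 + t)) ((t + 1) / t))
        - 1 / 2 * Real.log (1 + t) ^ 2) / t) t := by
  have ht1 : 1 + t ≠ 0 := by positivity
  have hL : HasDerivAt (fun s : ℝ => Real.log (1 + s)) (1 / (1 + t)) t :=
    ((hasDerivAt_id t).const_add 1).log ht1
  have hx : HasDerivAt (fun s : ℝ => (s + 1) / s) (-1 / t ^ 2) t := by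
    refine (((hasDerivAt_id t).add_const 1).div (hasDerivAt_id t) ht.ne').congr_deriv ?_
    simp only [id]
    ring
  have hsum : ∀ (c : ℕ → ℝ) (e : ℕ → ℕ), HasDerivAt
      (fun s : ℝ => ∑ k ∈ Finset.range (n + 1), c k * ((s + 1) / s) ^ e k)
      (∑ k ∈ Finset.range (n + 1), c k * (e k * ((t + 1) / t) ^ (e k - 1) * (-1 / t ^ 2))) t :=
    fun c e => HasDerivAt.fun_sum fun k _ => (hx.fun_pow (e k)).const_mul (c k)
  have hd := ((hL.fun_mul (hsum (fun j => H (j + 1) / ((j + 1 : ℕ) : ℝ)) (· + 1))).fun_sub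
    (((hL.fun_pow 2).const_mul (1 / 2)).fun_mul
      (hsum (fun j => 1 / ((j + 1 : ℕ) : ℝ)) (· + 1)))).fun_sub
    (hsum (fun p => innerCoeff p (n + 1 - p)) id)
  simp only [id] at hd
  have hrew : (fun s => polyPart (n + 1) (Real.log (1 + s)) ((s + 1) / s)) = _ :=
    funext fun s => by rw [polyPart, sum_Icc_one_eq_sum_range, sum_Icc_one_eq_sum_range]
  rw [hrew]
  refine hd.congr_deriv ?_
  rw [eq_div_iff ht.ne']
  have h := polyPart_succ_sub n (Real.log (1 + t)) ((t + 1) / t)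
  generalize hxv : (t + 1) / t = x at *
  generalize Real.log (1 + t) = L at *
  have htx : t * (x - 1) = 1 := by rw [← hxv]; field_simp; ring
  have hxt : t * x = 1 + t := by linear_combination htx
  have h1 := sum_H_succ_mul_pow (n + 1) x
  have h2 := sum_innerCoeff_mul_pow (n + 1) x
  have h3 := mul_neg_geom_sum x (n + 1)
  rw [Finset.sum_add_distrib, ← Finset.sum_mul] at h1
  have e1 : ∑ j ∈ Finset.range (n + 1), H (j + 1) / ((j + 1 : ℕ) : ℝ) * x ^ (j + 1)
      = x * ∑ j ∈ Finset.range (n + 1), H (j + 1) / ((j : ℝ) + 1) * x ^ j := by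
    rw [Finset.mul_sum]
    refine Finset.sum_congr rfl fun j _ => ?_
    push_cast
    ring
  have e2 : ∑ j ∈ Finset.range (n + 1), 1 / ((j + 1 : ℕ) : ℝ) * x ^ (j + 1)
      = x * ∑ j ∈ Finset.range (n + 1), x ^ j / ((j : ℝ) + 1) := by
    rw [Finset.mul_sum]
    refine Finset.sum_congr rfl fun j _ => ?_
    push_cast
    ring
  have e3 : ∑ j ∈ Finset.range (n + 1), H (j + 1) / ((j + 1 : ℕ) : ℝ) *
        (((j + 1 : ℕ) : ℝ) * x ^ (j + 1 - 1) * (-1 / t ^ 2))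
      = -1 / t ^ 2 * ∑ j ∈ Finset.range (n + 1), H (j + 1) * x ^ j := by
    rw [Finset.mul_sum]
    refine Finset.sum_congr rfl fun j _ => ?_
    rw [Nat.add_sub_cancel]
    field_simp
  have e4 : ∑ j ∈ Finset.range (n + 1), 1 / ((j + 1 : ℕ) : ℝ) *
        (((j + 1 : ℕ) : ℝ) * x ^ (j + 1 - 1) * (-1 / t ^ 2))
      = -1 / t ^ 2 * ∑ j ∈ Finset.range (n + 1), x ^ j := by
    rw [Finset.mul_sum]
    refine Finset.sum_congr rfl fun j _ => ?_
    rw [Nat.add_sub_cancel]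
    field_simp
  have e5 : ∑ p ∈ Finset.range (n + 1), innerCoeff p (n + 1 - p) *
        ((p : ℝ) * x ^ (p - 1) * (-1 / t ^ 2))
      = -1 / t ^ 2 * ∑ p ∈ Finset.range (n + 1), innerCoeff p (n + 1 - p) * (p * x ^ (p - 1)) := by
    rw [Finset.mul_sum]
    exact Finset.sum_congr rfl fun p _ => by ring
  have h4 : ((n : ℝ) + 1) * (polyPart n L x - polyPart (n + 1) L x)
      = -((L * H (n + 1) - 1 / 2 * L ^ 2) * x ^ (n + 1)) + (n + 1) * ∑ p ∈ Finset.range (n + 1),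
        (innerCoeff p (n + 1 - p) - innerCoeff p (n + 1 - p - 1)) * x ^ p := by
    have hn : (n : ℝ) + 1 ≠ 0 := by positivity
    have : polyPart (n + 1) L x = _ := eq_add_of_sub_eq h
    rw [this]
    field_simp
    ring
  -- `t L' = 1 / x` and `t x' = -(x - 1)`
  have hinv : 1 / (1 + t) = 1 / (t * x) := by rw [hxt]
  have hx0 : x ≠ 0 := by
    rintro rfl
    apply ht1
    rw [← hxt, mul_zero]
  have hinv2 : -1 / t ^ 2 = -(x - 1) / t := by
    field_simp
    linear_combination htx
  push_cast at h2
  rw [h4, ← h2, e1, e2, e3, e4, e5, hinv, hinv2]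
  generalize (∑ j ∈ Finset.range (n + 1), H (j + 1) / ((j : ℝ) + 1) * x ^ j) = S1 at *
  generalize (∑ j ∈ Finset.range (n + 1), x ^ j / ((j : ℝ) + 1)) = S2 at *
  generalize (∑ j ∈ Finset.range (n + 1), H (j + 1) * x ^ j) = S3 at *
  generalize (∑ j ∈ Finset.range (n + 1), x ^ j) = S4 at *
  generalize (∑ p ∈ Finset.range (n + 1), innerCoeff p (n + 1 - p) * (p * x ^ (p - 1))) = S5 at *
  field_simp
  norm_num
  linear_combination (-2 * L) * h1 - L ^ 2 * h3

/-! ### The polylogarithmic part -/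

/-- The part of the closed form that does not depend on `n`. -/
noncomputable def polylogPart (t : ℝ) : ℝ :=
  1 / 2 * Real.log t * Real.log (t + 1) ^ 2
    - 1 / 3 * Real.log (1 + t) ^ 3
    - Real.log (1 + t) * polylog 2 (1 / (1 + t))
    - polylog 3 (1 / (1 + t))
    + (riemannZeta 3).re

theorem hasDerivAt_polylogPart {t : ℝ} (ht : 0 < t) :
    HasDerivAt polylogPart (1 / 2 * Real.log (1 + t) ^ 2 / t) t := by
  have ht1 : 1 + t ≠ 0 := by positivity
  have hu0 : 1 / (1 + t) ≠ 0 := by positivity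
  have hu1 : |1 / (1 + t)| < 1 := by
    rw [abs_of_pos (by positivity), div_lt_one (by positivity)]
    linarith
  have hL : HasDerivAt (fun s : ℝ => Real.log (1 + s)) (1 / (1 + t)) t :=
    ((hasDerivAt_id t).const_add 1).log ht1
  have hL' : HasDerivAt (fun s : ℝ => Real.log (s + 1)) (1 / (1 + t)) t := by
    simpa only [add_comm] using hL
  have hu : HasDerivAt (fun s : ℝ => 1 / (1 + s)) (-1 / (1 + t) ^ 2) t := by
    simpa using ((hasDerivAt_id t).const_add 1).fun_inv ht1
  have h2 := (hasDerivAt_polylog 1 hu1 hu0).comp t hu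
  have h3 := (hasDerivAt_polylog 2 hu1 hu0).comp t hu
  have hd := ((((((Real.hasDerivAt_log ht.ne').const_mul (1 / 2)).fun_mul
    (hL'.fun_pow 2)).fun_sub ((hL.fun_pow 3).const_mul (1 / 3))).fun_sub
    (hL.fun_mul h2)).fun_sub h3).add_const (riemannZeta 3).re
  refine hd.congr_deriv ?_
  have hlog : Real.log (1 - 1 / (1 + t)) = Real.log t - Real.log (1 + t) := by
    rw [← Real.log_div ht.ne' ht1]
    congr 1
    field_simp
    ring
  simp only [Function.comp, polylog_one hu1, hlog, add_comm t 1]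
  field_simp
  norm_num
  ring


/-! ### Limits at zero -/

open Filter Topology Set in
theorem tendsto_log_one_add_zero :
    Tendsto (fun t : ℝ => Real.log (1 + t)) (𝓝[>] 0) (𝓝 0) := by
  have h : ContinuousAt (fun t : ℝ => Real.log (1 + t)) 0 :=
    ContinuousAt.log (by fun_prop) (by norm_num)
  simpa using h.tendsto.mono_left (nhdsWithin_le_nhds (s := Ioi 0))

open Filter Topology Set in
theorem tendsto_log_mul_log_one_add_sq :
    Tendsto (fun t : ℝ => Real.log t * Real.log (1 + t) ^ 2) (𝓝[>] 0) (𝓝 0) := by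
  have h0 : Tendsto (fun t : ℝ => |Real.log t * t|) (𝓝[>] 0) (𝓝 0) := by
    have h : Tendsto (fun t : ℝ => Real.log t * t) (𝓝[>] 0) (𝓝 0) := by
      simpa using tendsto_log_mul_rpow_nhdsGT_zero (r := 1) one_pos
    simpa using h.abs
  refine squeeze_zero_norm' ?_ h0
  filter_upwards [Ioo_mem_nhdsGT (zero_lt_one (α := ℝ))] with t ht
  have h1 : Real.log (1 + t) ≤ t := by
    have := Real.log_le_sub_one_of_pos (by linarith [ht.1] : 0 < 1 + t)
    linarith
  have h2 : 0 ≤ Real.log (1 + t) := Real.log_nonneg (by linarith [ht.1])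
  have h3 : Real.log (1 + t) ^ 2 ≤ |t| := by
    rw [abs_of_pos ht.1]
    nlinarith [ht.1, ht.2]
  rw [Real.norm_eq_abs, abs_mul, abs_mul, abs_of_nonneg (sq_nonneg (Real.log (1 + t)))]
  exact mul_le_mul_of_nonneg_left h3 (abs_nonneg _)

open Filter Topology Set in
theorem tendsto_polylog_one_div_one_add {s : ℕ} (hs : 2 ≤ s) :
    Tendsto (fun t : ℝ => polylog s (1 / (1 + t))) (𝓝[>] 0) (𝓝 (polylog s 1)) := by
  refine (continuousOn_polylog hs 1 (by simp)).tendsto.comp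
    (tendsto_nhdsWithin_iff.2 ⟨?_, ?_⟩)
  · have h : ContinuousAt (fun t : ℝ => 1 / (1 + t)) 0 :=
      continuousAt_const.div (by fun_prop) (by norm_num)
    simpa using h.tendsto.mono_left (nhdsWithin_le_nhds (s := Ioi 0))
  · filter_upwards [self_mem_nhdsWithin] with t ht
    have ht : 0 < t := ht
    have h1 : 0 < 1 / (1 + t) := by positivity
    exact ⟨by linarith, div_le_one_of_le₀ (by linarith) (by positivity)⟩

open Filter Topology Set in
theorem tendsto_polylogPart : Tendsto polylogPart (𝓝[>] 0) (𝓝 0) := by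
  have hL := tendsto_log_one_add_zero
  have h := ((((tendsto_log_mul_log_one_add_sq.const_mul (1 / 2)).sub
    ((hL.pow 3).const_mul (1 / 3))).sub
    (hL.mul (tendsto_polylog_one_div_one_add le_rfl))).sub
    (tendsto_polylog_one_div_one_add (s := 3) (by norm_num))).add_const (riemannZeta 3).re
  rw [← polylog_three_one] at h
  norm_num at h
  refine h.congr fun t => ?_
  rw [polylogPart, polylog_three_one, add_comm t 1]
  ring_nf

open Filter Topology Set in
/-- Multiplication by `t ^ n` cancels the poles of the powers of `(t + 1) / t` at `t = 0`: the
logarithms vanish there, and the remaining sum has powers less than `n` only. -/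
theorem tendsto_pow_mul_polyPart (n : ℕ) :
    Tendsto (fun t : ℝ => t ^ n * polyPart n (Real.log (1 + t)) ((t + 1) / t))
      (𝓝[>] 0) (𝓝 0) := by
  have hpow : ∀ t : ℝ, t ≠ 0 → ∀ k ≤ n, t ^ n * ((t + 1) / t) ^ k = (t + 1) ^ k * t ^ (n - k) := by
    intro t ht k hk
    rw [div_pow, ← Nat.sub_add_cancel hk, pow_add, Nat.add_sub_cancel]
    field_simp
  have hcont : ∀ (s : Finset ℕ) (c : ℕ → ℝ), Tendsto
      (fun t : ℝ => ∑ k ∈ s, c k * ((t + 1) ^ k * t ^ (n - k))) (𝓝[>] 0)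
      (𝓝 (∑ k ∈ s, c k * ((0 + 1) ^ k * 0 ^ (n - k)))) := fun s c =>
    (Continuous.tendsto (f := fun t : ℝ => ∑ k ∈ s, c k * ((t + 1) ^ k * t ^ (n - k)))
      (by fun_prop) 0).mono_left nhdsWithin_le_nhds
  have hL := tendsto_log_one_add_zero
  have h := ((hL.mul (hcont (Finset.Icc 1 n) fun k => H k / (k : ℝ))).sub
    (((hL.pow 2).const_mul (1 / 2)).mul (hcont (Finset.Icc 1 n) fun k => 1 / (k : ℝ)))).sub
    (hcont (Finset.range n) fun p => innerCoeff p (n - p))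
  have h0 : ∑ p ∈ Finset.range n, innerCoeff p (n - p) * ((0 + 1) ^ p * (0 : ℝ) ^ (n - p)) = 0 :=
    Finset.sum_eq_zero fun p hp => by
      rw [zero_pow (Nat.sub_ne_zero_of_lt (Finset.mem_range.1 hp)), mul_zero, mul_zero]
  rw [h0, zero_mul, zero_pow two_ne_zero, mul_zero, zero_mul, sub_zero, sub_zero] at h
  refine h.congr' ?_
  filter_upwards [self_mem_nhdsWithin] with t ht
  have ht : t ≠ 0 := (mem_Ioi.1 ht).ne'
  have hsum : ∀ (s : Finset ℕ) (c : ℕ → ℝ), (∀ k ∈ s, k ≤ n) →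
      ∑ k ∈ s, c k * ((t + 1) ^ k * t ^ (n - k)) = t ^ n * ∑ k ∈ s, c k * ((t + 1) / t) ^ k := by
    intro s c hs
    rw [Finset.mul_sum]
    refine Finset.sum_congr rfl fun k hk => ?_
    rw [← hpow t ht k (hs k hk)]
    ring
  rw [hsum _ _ fun k hk => (Finset.mem_Icc.1 hk).2, hsum _ _ fun k hk => (Finset.mem_Icc.1 hk).2,
    hsum _ _ fun k hk => (Finset.mem_range.1 hk).le, polyPart]
  ring

open Filter Topology Set in
theorem continuousOn_powSeries_binomCoeff (n : ℕ) :
    ContinuousOn (fun t => powSeries (binomCoeff n) (-t)) (Icc 0 1) :=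
  (continuousOn_powSeries (summable_abs_binomCoeff n)).comp continuousOn_neg
    fun t ht => ⟨by linarith [ht.2], by linarith [ht.1]⟩

open Filter Topology Set in
theorem tendsto_powSeries_binomCoeff (n : ℕ) :
    Tendsto (fun t => powSeries (binomCoeff n) (-t)) (𝓝[>] 0) (𝓝 0) := by
  have hb : |(-0 : ℝ)| < 1 := by simp
  have h : ContinuousAt (fun t : ℝ => powSeries (binomCoeff n) (-t)) 0 :=
    ContinuousAt.comp (f := fun t : ℝ => -t)
      (hasDerivAt_powSeries_tsum (abs_binomCoeff_le_one n) hb).continuousAt continuousAt_neg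
  simpa [powSeries_zero] using h.tendsto.mono_left (nhdsWithin_le_nhds (s := Ioi 0))

/-! ### Comparison of the series with the closed form -/

open Filter Topology Set in
theorem powSeries_binomCoeff_eq (n : ℕ) {t : ℝ} (ht0 : 0 < t) (ht1 : t ≤ 1) :
    powSeries (binomCoeff n) (-t)
      = polylogPart t + polyPart n (Real.log (1 + t)) ((t + 1) / t) := by
  induction n generalizing t with
  | zero =>
    have hd : ∀ s : ℝ, 0 < s → s < 1 →
        HasDerivAt (fun s => powSeries (binomCoeff 0) (-s) - polylogPart s) 0 s := fun s h0 h1 =>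
      ((hasDerivAt_powSeries_binomCoeff_zero h0 h1).sub (hasDerivAt_polylogPart h0)).congr_deriv
        (sub_self _)
    have h := eq_zero_of_hasDerivAt_zero_of_tendsto_zero ht0
      (f := fun s => powSeries (binomCoeff 0) (-s) - polylogPart s)
      (((continuousOn_powSeries_binomCoeff 0).mono fun s hs => ⟨hs.1.le, hs.2.trans ht1⟩).sub
        fun s hs => (hasDerivAt_polylogPart hs.1).continuousAt.continuousWithinAt)
      (fun s hs => hd s hs.1 (hs.2.trans_le ht1))
      (by simpa using (tendsto_powSeries_binomCoeff 0).sub tendsto_polylogPart)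
    simp only [polyPart, Finset.range_zero, Finset.sum_empty, Finset.Icc_eq_empty_of_lt one_pos]
    linarith
  | succ n ih =>
    set P : ℝ → ℝ := fun s => polyPart (n + 1) (Real.log (1 + s)) ((s + 1) / s) with hP
    set f : ℝ → ℝ := fun s =>
      s ^ (n + 1) * (powSeries (binomCoeff (n + 1)) (-s) - (polylogPart s + P s)) with hf
    have hG : ∀ s : ℝ, 0 < s → HasDerivAt (fun s => polylogPart s + P s) _ s := fun s hs =>
      (hasDerivAt_polylogPart hs).fun_add (hasDerivAt_polyPart n hs)
    have hd : ∀ s ∈ Ioo 0 t, HasDerivAt f 0 s := by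
      intro s hs
      have hs0 : s ≠ 0 := hs.1.ne'
      refine ((hasDerivAt_pow (n + 1) s).fun_mul
        ((hasDerivAt_powSeries_binomCoeff_succ n hs.1 (hs.2.trans_le ht1)).fun_sub
          (hG s hs.1))).congr_deriv ?_
      rw [ih hs.1 (hs.2.le.trans ht1), Nat.add_sub_cancel, pow_succ]
      simp only [hP]
      push_cast
      field_simp
      ring
    have h := eq_zero_of_hasDerivAt_zero_of_tendsto_zero ht0 (f := f)
      ((continuousOn_pow (n + 1)).mul
        (((continuousOn_powSeries_binomCoeff (n + 1)).mono
          fun s hs => ⟨hs.1.le, hs.2.trans ht1⟩).sub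
          fun s hs => (hG s hs.1).continuousAt.continuousWithinAt))
      hd ?_
    · have h1 := (mul_eq_zero.1 h).resolve_left (pow_ne_zero _ ht0.ne')
      exact sub_eq_zero.1 h1
    · have hpow : Tendsto (fun s : ℝ => s ^ (n + 1)) (𝓝[>] 0) (𝓝 0) := by
        have := ((continuous_pow (M := ℝ) (n + 1)).tendsto 0).mono_left
          (nhdsWithin_le_nhds (s := Ioi 0))
        rwa [zero_pow n.succ_ne_zero] at this
      have hlim := (hpow.mul ((tendsto_powSeries_binomCoeff (n + 1)).sub tendsto_polylogPart)).sub
        (tendsto_pow_mul_polyPart (n + 1))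
      rw [zero_mul, sub_zero] at hlim
      refine hlim.congr fun s => ?_
      simp only [hf, hP]
      ring

theorem theorem2p14 (n : ℕ) (t : ℝ) (ht0 : 0 < t) (ht1 : t ≤ 1) :
    HasSum
      -- the term of index `k = j + 1`, for `j = 0, 1, 2, …`
      (fun j : ℕ =>
        (-t) ^ (j + 1) * H j /
          (((j + 1 : ℕ) : ℝ) ^ 2 * ((n + (j + 1)).choose (j + 1) : ℝ)))
      (1 / 2 * Real.log t * Real.log (t + 1) ^ 2
        - 1 / 3 * Real.log (1 + t) ^ 3
        - Real.log (1 + t) * polylog 2 (1 / (1 + t))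
        - polylog 3 (1 / (1 + t))
        + (riemannZeta 3).re
        + Real.log (1 + t) * ∑ k ∈ Finset.Icc 1 n, H k / (k : ℝ) * ((t + 1) / t) ^ k
        - 1 / 2 * Real.log (1 + t) ^ 2 * ∑ k ∈ Finset.Icc 1 n, 1 / (k : ℝ) * ((t + 1) / t) ^ k
        - ∑ p ∈ Finset.range n,
            (∑ k ∈ Finset.Icc 1 (n - p),
              ((H (p + k) - H k) / (((p : ℝ) + (k : ℝ)) * (k : ℝ))
                + 1 / ((k : ℝ) ^ 2 * ((p : ℝ) + (k : ℝ)))))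
              * ((t + 1) / t) ^ p) := by
  have hs : Summable fun j : ℕ => binomCoeff n j * (-t) ^ (j + 1) := by
    refine Summable.of_norm_bounded (summable_abs_binomCoeff n) fun j => ?_
    rw [norm_mul, norm_pow, Real.norm_eq_abs, Real.norm_eq_abs, abs_neg, abs_of_pos ht0]
    exact mul_le_of_le_one_right (abs_nonneg _) (pow_le_one₀ ht0.le ht1)
  have h := hs.hasSum
  rw [← powSeries, powSeries_binomCoeff_eq n ht0 ht1] at h
  convert h using 1
  · funext j
    rw [binomCoeff]
    ring
  · simp only [polylogPart, polyPart, innerCoeff]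
    ring
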